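/- Let $S$ be a nonempty standard Borel space. A (conservative, stable) $Q$-function on $S$ is a measurable signed kernel $q(dy|x,s)$ on $S$ from $S\times[0,\infty)$ such that $0\le q(\Gamma|x,s)<\infty$ whenever $x\notin\Gamma$, $q(S|x,s)=0$, and $\sup_{s\ge 0}q(S\setminus\{x\}|x,s)<\infty$ for each $x\in S$. Put $\tilde q(\Gamma|x,s)=q(\Gamma\setminus\{x\}|x,s)$ and $q_x(s)=-q(\{x\}|x,s)$. The pure jump process of $q$ started from $x\in S$ at time $0$ has jump times and post-jump states $(t_n,x_n)_{n\ge 0}$ with $(t_0,x_0)=(0,x)$ and with the following law $\mathbb P_x^q$: given $t_0,x_0,\dots,t_n=v<\infty,x_n=z$, the pair $(t_{n+1},x_{n+1})$ has the distribution $e^{-\int_v^t q_z(s)ds}\,\tilde q(dy|z,t)\,dt$ on $(v,\infty)\times S$, and with the remaining probability there are no further jumps, i.e. $t_m=\infty$ for all $m>n$. The process is called nonexplosive if $\mathbb P_x^q(\lim_n t_n=\infty)=1$ for every $x\in S$. For $\alpha>0$ let $p^\alpha$ be the transition probability on $E=([0,\infty)\times S)\cup\{(\infty,\Delta)\}$,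 where $(\infty,\Delta)$ is an isolated absorbing point, given for $(v,x)\in[0,\infty)\times S$ by $$p^\alpha(\Gamma_1\times\Gamma_2|v,x)=\int_{\Gamma_1\cap(v,\infty)}e^{-\int_0^{t-v}(\alpha+q_x(s+v))ds}\,\tilde q(\Gamma_2|x,t)\,dt,\qquad \Gamma_1\in\mathcal B([0,\infty)),\ \Gamma_2\in\mathcal B(S),$$ with the remaining mass placed at $(\infty,\Delta)$. A Markov chain $(\Phi_n)$ on $E$ is called Harris recurrent with respect to a measure $\psi$ if $\psi$ is a maximal irreducibility measure (that is, $\psi\ne0$; $\psi(A)>0$ implies $P_z(\Phi_n\in A\text{ for some }n\ge1)>0$ for all $z\in E$; and every other nonzero measure with this property is absolutely continuous with respect to $\psi$) and, for every measurable $A$ with $\psi(A)>0$ and every $z\in A$, $P_z(\Phi_n\in A\text{ for infinitely many }n)=1$. **Theorem.** For every $Q$-function $q$ on $S$, the following three assertions are equivalent. 1. The pure jump process of $q$ is nonexplosive. 2. (a) There is $\alpha\in(0,\infty)$ such that the Markov chain with transition probability $p^\alpha$ is Harris recurrent with respect to the Dirac measure at $(\infty,\Delta)$. 3. (b) For each $\alpha\in(0,\infty)$,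 the only measurable function $U:[0,\infty)\times S\to[0,1]$ satisfying $$U(v,x)=\int_0^\infty\int_S U(v+t,y)\,\tilde q(dy|x,v+t)\,e^{-\alpha t-\int_0^t q_x(s+v)ds}\,dt\qquad\text{for all }x\in S,\ v\in[0,\infty)$$ is $U\equiv0$. -/

import Mathlib

open MeasureTheory ProbabilityTheory Set Filter
open scoped NNReal ENNReal

namespace PureJump

section Chain

variable {E : Type*} [MeasurableSpace E]

/-- The law on `ℕ → E` of the homogeneous discrete-time Markov chain with transition probability
`κ` and initial state `x` (Ionescu-Tulcea). -/
noncomputable def chainLaw (κ : Kernel E E) [IsMarkovKernel κ] (x : E) : Measure (ℕ → E) :=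
  Kernel.traj (X := fun _ : ℕ => E)
    (fun n => κ.comap (fun h : ((i : Finset.Iic n) → E) => h ⟨n, Finset.mem_Iic.2 le_rfl⟩)
      (measurable_pi_apply _)) 0 (fun _ => x)

/-- `φ` is an irreducibility measure of the chain: it is nontrivial and every set which is charged
by `φ` is reached at some time `n ≥ 1` with positive probability, from every initial state. -/
def IsIrreducibilityMeasure (κ : Kernel E E) [IsMarkovKernel κ] (φ : Measure E) : Prop :=
  φ ≠ 0 ∧ ∀ A : Set E, MeasurableSet A → 0 < φ A →
    ∀ x : E, 0 < chainLaw κ x {ω | ∃ n : ℕ, 1 ≤ n ∧ ω n ∈ A}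

/-- `ψ` is a maximal irreducibility measure: it dominates all irreducibility measures. -/
def IsMaximalIrreducibilityMeasure (κ : Kernel E E) [IsMarkovKernel κ] (ψ : Measure E) : Prop :=
  IsIrreducibilityMeasure κ ψ ∧ ∀ φ : Measure E, IsIrreducibilityMeasure κ φ → φ ≪ ψ

/-- The chain is Harris recurrent, with (maximal) irreducibility measure `ψ`: it is
`ψ`-irreducible, and every measurable set `A` with `ψ A > 0` is visited infinitely often almost
surely from every initial state in `A`. -/
def IsHarrisRecurrent (κ : Kernel E E) [IsMarkovKernel κ] (ψ : Measure E) : Prop :=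
  IsMaximalIrreducibilityMeasure κ ψ ∧ ∀ A : Set E, MeasurableSet A → 0 < ψ A →
    ∀ x ∈ A, chainLaw κ x {ω | ∃ᶠ n in atTop, ω n ∈ A} = 1

end Chain

/-- A (conservative, stable) `Q`-function on `S`: `rate x s Γ` is `q(Γ | x, s)`. -/
structure QFunction (S : Type*) [MeasurableSpace S] where
  rate : S → ℝ≥0 → SignedMeasure S
  measurable_rate : ∀ Γ : Set S, MeasurableSet Γ →
    Measurable fun p : S × ℝ≥0 => rate p.1 p.2 Γ
  rate_nonneg : ∀ (x : S) (s : ℝ≥0) (Γ : Set S), MeasurableSet Γ → x ∉ Γ → 0 ≤ rate x s Γ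
  rate_univ : ∀ (x : S) (s : ℝ≥0), rate x s univ = 0
  bddAbove_rate : ∀ x : S, BddAbove (range fun s : ℝ≥0 => rate x s {x}ᶜ)

/-- Lebesgue measure on `[0,∞)`. -/
noncomputable def leb : Measure ℝ≥0 := (volume.restrict (Ici (0 : ℝ))).map Real.toNNReal

instance : SFinite leb := by unfold leb; infer_instance

lemma lintegral_leb {f : ℝ≥0 → ℝ≥0∞} (hf : Measurable f) :
    ∫⁻ t, f t ∂leb = ∫⁻ t in Ici (0 : ℝ), f t.toNNReal := by
  rw [leb, lintegral_map hf measurable_real_toNNReal]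

namespace QFunction

variable {S : Type*} [MeasurableSpace S] (q : QFunction S)

lemma measurable_rate_section {D : Set ((S × ℝ≥0) × S)} (hD : MeasurableSet D) :
    Measurable fun p : S × ℝ≥0 => q.rate p.1 p.2 (Prod.mk p ⁻¹' D) := by
  induction D, hD using MeasurableSpace.induction_on_inter generateFrom_prod.symm
    isPiSystem_prod with
  | empty => simp
  | basic D hD =>
    obtain ⟨A, hA, B, hB, rfl⟩ := hD
    classical
    have : (fun p : S × ℝ≥0 => q.rate p.1 p.2 (Prod.mk p ⁻¹' A ×ˢ B))
        = A.indicator fun p => q.rate p.1 p.2 B := by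
      ext p
      by_cases hp : p ∈ A <;> simp [hp]
    rw [this]
    exact (q.measurable_rate B hB).indicator hA
  | compl D hD ih =>
    have : (fun p : S × ℝ≥0 => q.rate p.1 p.2 (Prod.mk p ⁻¹' Dᶜ))
        = fun p => -q.rate p.1 p.2 (Prod.mk p ⁻¹' D) := by
      ext p
      have h := VectorMeasure.of_add_of_sdiff (v := q.rate p.1 p.2)
        (measurable_prodMk_left (x := p) hD) MeasurableSet.univ (subset_univ _)
      rw [q.rate_univ, ← compl_eq_univ_sdiff] at h
      rw [preimage_compl]
      linarith
    rw [this]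
    exact ih.neg
  | iUnion f hd hf ih =>
    have hs : ∀ p : S × ℝ≥0, HasSum (fun i => q.rate p.1 p.2 (Prod.mk p ⁻¹' f i))
        (q.rate p.1 p.2 (Prod.mk p ⁻¹' ⋃ i, f i)) := by
      intro p
      rw [preimage_iUnion]
      exact VectorMeasure.hasSum_of_disjoint_iUnion
        (fun i => measurable_prodMk_left (hf i)) fun i j hij => (hd hij).preimage _
    refine measurable_of_tendsto_metrizable
      (f := fun (n : ℕ) (p : S × ℝ≥0) =>
        ∑ i ∈ Finset.range n, q.rate p.1 p.2 (Prod.mk p ⁻¹' f i)) (fun n => ?_) ?_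
    · exact Finset.measurable_fun_sum _ fun i _ => ih i
    · exact tendsto_pi_nhds.2 fun p => (hs p).tendsto_sum_nat

variable [StandardBorelSpace S]

/-- `q_x(s) = -q({x} | x, s)`. -/
noncomputable def exitRate (x : S) (s : ℝ≥0) : ℝ := -q.rate x s {x}

/-- The measure `q̃(Γ | x, s) = q(Γ \ {x} | x, s)`. -/
noncomputable def jumpMeasure (x : S) (s : ℝ≥0) : Measure S :=
  (q.rate x s).toMeasureOfZeroLE {x}ᶜ (measurableSet_singleton x).compl
    (VectorMeasure.restrict_le_restrict_of_subset_le _ _ fun _ hj hjx =>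
      q.rate_nonneg x s _ hj fun hx => hjx hx rfl)

lemma jumpMeasure_apply (x : S) (s : ℝ≥0) {Γ : Set S} (hΓ : MeasurableSet Γ) :
    q.jumpMeasure x s Γ = ENNReal.ofReal (q.rate x s (Γ \ {x})) := by
  have h0 : 0 ≤ q.rate x s (Γ \ {x}) :=
    q.rate_nonneg x s _ (hΓ.diff (measurableSet_singleton x)) (by simp)
  have he : {x}ᶜ ∩ Γ = Γ \ {x} := by rw [inter_comm]; rfl
  rw [jumpMeasure, SignedMeasure.toMeasureOfZeroLE_apply _ _ _ hΓ, ENNReal.ofReal]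
  congr 1
  apply NNReal.eq
  simp only [NNReal.coe_mk, he, Real.coe_toNNReal _ h0]

lemma rate_compl (x : S) (s : ℝ≥0) : q.rate x s {x}ᶜ = q.exitRate x s := by
  have h := VectorMeasure.of_add_of_sdiff (v := q.rate x s) (measurableSet_singleton x)
    MeasurableSet.univ (subset_univ _)
  rw [q.rate_univ, ← compl_eq_univ_sdiff] at h
  unfold exitRate
  linarith

lemma exitRate_nonneg (x : S) (s : ℝ≥0) : 0 ≤ q.exitRate x s := by
  rw [← q.rate_compl]
  exact q.rate_nonneg x s _ (measurableSet_singleton x).compl (by simp)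

lemma exists_exitRate_le (x : S) : ∃ C : ℝ, ∀ s, q.exitRate x s ≤ C := by
  obtain ⟨C, hC⟩ := q.bddAbove_rate x
  exact ⟨C, fun s => by rw [← q.rate_compl]; exact hC ⟨s, rfl⟩⟩

lemma jumpMeasure_univ (x : S) (s : ℝ≥0) :
    q.jumpMeasure x s univ = ENNReal.ofReal (q.exitRate x s) := by
  rw [q.jumpMeasure_apply x s MeasurableSet.univ, ← compl_eq_univ_sdiff, q.rate_compl]

/-- The kernel `q̃(dy | x, s)`. -/
noncomputable def jumpRates : Kernel (S × ℝ≥0) S where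
  toFun p := q.jumpMeasure p.1 p.2
  measurable' := by
    refine Measure.measurable_of_measurable_coe _ fun Γ hΓ => ?_
    simp only [q.jumpMeasure_apply _ _ hΓ]
    have hD : MeasurableSet {z : (S × ℝ≥0) × S | z.2 ∈ Γ ∧ z.2 ≠ z.1.1} :=
      (measurable_snd hΓ).inter
        (measurableSet_eq_fun measurable_snd (measurable_fst.comp measurable_fst)).compl
    exact (q.measurable_rate_section hD).ennreal_ofReal

lemma jumpRates_univ (x : S) (s : ℝ≥0) :
    q.jumpRates (x, s) univ = ENNReal.ofReal (q.exitRate x s) := q.jumpMeasure_univ x s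

lemma measurable_exitRate : Measurable fun p : S × ℝ≥0 => q.exitRate p.1 p.2 := by
  have hD : MeasurableSet {z : (S × ℝ≥0) × S | z.2 = z.1.1} :=
    measurableSet_eq_fun measurable_snd (measurable_fst.comp measurable_fst)
  exact (q.measurable_rate_section hD).neg

instance : IsSFiniteKernel q.jumpRates := by
  classical
  set N : S × ℝ≥0 → ℕ := fun p => ⌊q.exitRate p.1 p.2⌋₊
  have hN : Measurable N := Nat.measurable_floor.comp q.measurable_exitRate
  have hs : ∀ n, MeasurableSet (N ⁻¹' {n}) := fun n => hN (measurableSet_singleton n)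
  have hsum : q.jumpRates = Kernel.sum fun n => Kernel.piecewise (hs n) q.jumpRates 0 := by
    ext p Γ hΓ
    rw [Kernel.sum_apply' _ _ hΓ, tsum_eq_single (N p)]
    · simp [Kernel.piecewise_apply]
    · intro n hn
      rw [Kernel.piecewise_apply, if_neg]
      · simp
      · exact fun h => hn h.symm
  rw [hsum]
  have : ∀ n, IsFiniteKernel (Kernel.piecewise (hs n) q.jumpRates 0) := by
    intro n
    refine ⟨⟨ENNReal.ofReal (n + 1), ENNReal.ofReal_lt_top, fun p => ?_⟩⟩
    rw [Kernel.piecewise_apply]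
    split_ifs with hp
    · rw [q.jumpRates_univ]
      refine ENNReal.ofReal_le_ofReal ?_
      have : ⌊q.exitRate p.1 p.2⌋₊ = n := hp
      rw [← this]
      exact (Nat.lt_floor_add_one _).le
    · simp
  infer_instance

/-- `exp (-α t - ∫₀ᵗ q_x(s + v) ds)`. -/
noncomputable def survival (α v : ℝ≥0) (x : S) (t : ℝ≥0) : ℝ≥0 :=
  Real.toNNReal <| Real.exp <|
    -(α * t : ℝ) - ∫ s in (0 : ℝ)..t, q.exitRate x (s.toNNReal + v)

lemma measurable_survival (α : ℝ≥0) :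
    Measurable fun z : (ℝ≥0 × S) × ℝ≥0 => q.survival α z.1.1 z.1.2 z.2 := by
  have h : Measurable fun z : (ℝ≥0 × S) × ℝ≥0 =>
      ∫ s : ℝ, (Ioc 0 (z.2 : ℝ)).indicator (fun s => q.exitRate z.1.2 (s.toNNReal + z.1.1)) s := by
    refine (StronglyMeasurable.integral_prod_right (f := fun (z : (ℝ≥0 × S) × ℝ≥0) (s : ℝ) =>
      (Ioc 0 (z.2 : ℝ)).indicator (fun s => q.exitRate z.1.2 (s.toNNReal + z.1.1)) s)
      (Measurable.stronglyMeasurable ?_)).measurable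
    have hg : Measurable fun w : ((ℝ≥0 × S) × ℝ≥0) × ℝ =>
        q.exitRate w.1.1.2 (w.2.toNNReal + w.1.1.1) :=
      q.measurable_exitRate.comp (by fun_prop :
        Measurable fun w : ((ℝ≥0 × S) × ℝ≥0) × ℝ => (w.1.1.2, w.2.toNNReal + w.1.1.1))
    have hD : MeasurableSet {w : ((ℝ≥0 × S) × ℝ≥0) × ℝ | w.2 ∈ Ioc 0 (w.1.2 : ℝ)} :=
      (measurableSet_lt measurable_const measurable_snd).inter
        (measurableSet_le measurable_snd (by fun_prop))
    exact hg.indicator hD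
  simp_rw [integral_indicator measurableSet_Ioc] at h
  unfold survival
  simp_rw [intervalIntegral.integral_of_le (NNReal.coe_nonneg _)]
  exact measurable_real_toNNReal.comp (Real.measurable_exp.comp (by fun_prop))

/-- The part on `[0,∞) × S` of the transition probability out of `(v, x)`, namely
`Γ₁ × Γ₂ ↦ ∫_{Γ₁ ∩ (v,∞)} exp (-∫₀^{t-v} (α + q_x(s+v)) ds) q̃(Γ₂ | x, t) dt`. -/
noncomputable def jumpPart (α : ℝ≥0) : Kernel (ℝ≥0 × S) (ℝ≥0 × S) :=
  ((Kernel.const (ℝ≥0 × S) leb).withDensity fun p t =>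
      (((if p.1 < t then q.survival α p.1 p.2 (t - p.1) else 0 : ℝ≥0)) : ℝ≥0∞)) ⊗ₖ
    q.jumpRates.comap (fun z : (ℝ≥0 × S) × ℝ≥0 => (z.1.2, z.2)) (by fun_prop)

lemma measurable_density (α : ℝ≥0) : Measurable (Function.uncurry
    fun (p : ℝ≥0 × S) (t : ℝ≥0) =>
      (((if p.1 < t then q.survival α p.1 p.2 (t - p.1) else 0 : ℝ≥0)) : ℝ≥0∞)) := by
  refine Measurable.coe_nnreal_ennreal (Measurable.ite ?_ ?_ measurable_const)
  · exact measurableSet_lt (by fun_prop) (by fun_prop)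
  · exact (q.measurable_survival α).comp (by fun_prop :
      Measurable fun z : (ℝ≥0 × S) × ℝ≥0 => (z.1, z.2 - z.1.1))

lemma jumpPart_univ (α : ℝ≥0) (p : ℝ≥0 × S) : q.jumpPart α p univ =
    ∫⁻ t, ((if p.1 < t then q.survival α p.1 p.2 (t - p.1) else 0 : ℝ≥0) : ℝ≥0∞) *
      ENNReal.ofReal (q.exitRate p.2 t) ∂leb := by
  rw [jumpPart, Kernel.compProd_apply MeasurableSet.univ,
    Kernel.lintegral_withDensity _ (q.measurable_density α)]
  · simp [jumpRates_univ]
  · simp only [preimage_univ, Kernel.comap_apply, jumpRates_univ]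
    exact (q.measurable_exitRate.comp (by fun_prop :
      Measurable fun t : ℝ≥0 => (p.2, t))).ennreal_ofReal

end QFunction

/-- The first event of a hazard rate `h ≥ 0` happens in finite time with probability at most one. -/
lemma lintegral_exp_hazard_le_one {h : ℝ → ℝ} (hm : Measurable h) (h0 : ∀ t, 0 ≤ h t) {C : ℝ}
    (hC : ∀ t, h t ≤ C) :
    ∫⁻ t in Ioi (0 : ℝ), ENNReal.ofReal (Real.exp (-∫ s in (0 : ℝ)..t, h s) * h t) ≤ 1 := by
  have hi : ∀ a b : ℝ, IntervalIntegrable h volume a b := fun a b => by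
    refine (intervalIntegrable_const (c := C)).mono_fun hm.aestronglyMeasurable ?_
    filter_upwards with t
    rw [Real.norm_of_nonneg (h0 t), Real.norm_of_nonneg ((h0 t).trans (hC t))]
    exact hC t
  have hC0 : 0 ≤ C := (h0 0).trans (hC 0)
  set H : ℝ → ℝ := fun t => ∫ s in (0 : ℝ)..t, h s with hH
  set f : ℝ → ℝ := fun t => Real.exp (-H t) with hf
  have hsub : ∀ a b, H b - H a = ∫ s in a..b, h s := fun a b =>
    intervalIntegral.integral_interval_sub_left (hi _ _) (hi _ _)
  have hHmono : Monotone H := fun a b hab => by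
    have := intervalIntegral.integral_nonneg (μ := volume) hab fun s _ => h0 s
    linarith [hsub a b]
  have hHlip : ∀ a b, a ≤ b → H b - H a ≤ C * (b - a) := fun a b hab => by
    rw [hsub]
    calc ∫ s in a..b, h s ≤ ∫ _ in a..b, C :=
          intervalIntegral.integral_mono_on hab (hi _ _) intervalIntegrable_const fun s _ => hC s
      _ = C * (b - a) := by simp [mul_comm]
  have hH0 : H 0 = 0 := by simp [hH]
  have hHc : Continuous H := intervalIntegral.continuous_primitive hi 0
  have hflip : ∀ a b, 0 ≤ a → a ≤ b → |f a - f b| ≤ C * (b - a) := fun a b ha hab => by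
    have h1 : f b ≤ f a := Real.exp_le_exp.2 (neg_le_neg (hHmono hab))
    have h2 : f b = f a * Real.exp (-(H b - H a)) := by
      simp only [hf, ← Real.exp_add]; congr 1; ring
    have h3 : f a ≤ 1 := Real.exp_le_one_iff.2 (by linarith [hHmono ha])
    have h4 : 1 - (H b - H a) ≤ Real.exp (-(H b - H a)) := by
      linarith [Real.add_one_le_exp (-(H b - H a))]
    have h5 : 0 < f a := Real.exp_pos _
    have h6 : 0 ≤ H b - H a := by linarith [hHmono hab]
    rw [abs_of_nonneg (by linarith)]
    nlinarith [hHlip a b hab]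
  have key : ∀ n : ℕ, ∫⁻ t in Ioc (0 : ℝ) n, ENNReal.ofReal (f t * h t) ≤ 1 := by
    intro n
    have hac : AbsolutelyContinuousOnInterval f 0 n := by
      refine LipschitzOnWith.absolutelyContinuousOnInterval (K := ⟨C, hC0⟩) ?_
      refine LipschitzOnWith.of_dist_le_mul fun a ha b hb => ?_
      rw [uIcc_of_le (Nat.cast_nonneg n)] at ha hb
      rw [Real.dist_eq, Real.dist_eq]
      rcases le_total a b with hab | hab
      · rw [abs_of_nonpos (by linarith : a - b ≤ 0)]
        rw [neg_sub]
        exact hflip a b ha.1 hab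
      · rw [abs_of_nonneg (by linarith : 0 ≤ a - b), abs_sub_comm]
        exact hflip b a hb.1 hab
    have hderiv : ∀ᵐ t : ℝ, deriv f t = -(f t * h t) := by
      have hloc : LocallyIntegrable h volume := by
        intro t
        refine ⟨Ioc (t - 1) (t + 1), Ioc_mem_nhds (by linarith) (by linarith), ?_⟩
        exact (intervalIntegrable_iff_integrableOn_Ioc_of_le (by linarith)).1 (hi _ _)
      filter_upwards [LocallyIntegrable.ae_hasDerivAt_integral hloc] with t ht
      have := (ht 0).neg.exp.deriv
      rw [hf, hH]
      simp only at this ⊢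
      rw [show (fun t => Real.exp (-∫ s in (0 : ℝ)..t, h s)) =
        fun x => Real.exp ((-fun x => ∫ s in (0 : ℝ)..x, h s) x) from rfl, this]
      simp
    have hint := hac.integral_deriv_eq_sub
    rw [intervalIntegral.integral_congr_ae (hderiv.mono fun t ht _ => ht),
      intervalIntegral.integral_neg] at hint
    have hfm : Measurable f := Real.measurable_exp.comp hHc.measurable.neg
    have hfi : IntegrableOn (fun t => f t * h t) (Ioc 0 (n : ℝ)) := by
      refine (intervalIntegrable_iff_integrableOn_Ioc_of_le (Nat.cast_nonneg n)).1 ?_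
      exact (hi _ _).continuousOn_mul (Real.continuous_exp.comp hHc.neg).continuousOn
    rw [← ofReal_integral_eq_lintegral_ofReal hfi
      (ae_of_all _ fun t => mul_nonneg (Real.exp_pos _).le (h0 t)),
      ← intervalIntegral.integral_of_le (Nat.cast_nonneg n)]
    rw [ENNReal.ofReal_le_one]
    have hfn : 0 < f n := Real.exp_pos _
    have hf0 : f 0 = 1 := by simp [hf, hH0]
    linarith
  have hU : Ioi (0 : ℝ) = ⋃ n : ℕ, Ioc (0 : ℝ) n := by
    ext t
    simp only [mem_Ioi, mem_iUnion, mem_Ioc]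
    exact ⟨fun ht => (exists_nat_ge t).imp fun n hn => ⟨ht, hn⟩, fun ⟨n, hn⟩ => hn.1⟩
  rw [hU, setLIntegral_iUnion_of_directed]
  · exact iSup_le key
  · refine directed_of_isDirected_le fun m n hmn => ?_
    exact Ioc_subset_Ioc_right (Nat.cast_le.2 hmn)

namespace QFunction

variable {S : Type*} [MeasurableSpace S] [StandardBorelSpace S] (q : QFunction S)

lemma jumpPart_univ_le_one (α : ℝ≥0) (p : ℝ≥0 × S) : q.jumpPart α p univ ≤ 1 := by
  obtain ⟨v, x⟩ := p
  obtain ⟨C, hC⟩ := q.exists_exitRate_le x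
  have hgm : Measurable fun s : ℝ => q.exitRate x (s.toNNReal + v) :=
    q.measurable_exitRate.comp (by fun_prop : Measurable fun s : ℝ => (x, s.toNNReal + v))
  have hgi : ∀ t : ℝ, IntervalIntegrable (fun s : ℝ => q.exitRate x (s.toNNReal + v))
      volume 0 t := fun t => by
    refine (intervalIntegrable_const (c := C)).mono_fun hgm.aestronglyMeasurable ?_
    filter_upwards with s
    rw [Real.norm_of_nonneg (q.exitRate_nonneg _ _),
      Real.norm_of_nonneg ((q.exitRate_nonneg x 0).trans (hC 0))]
    exact hC _
  have hmain := lintegral_exp_hazard_le_one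
    (h := fun s : ℝ => (α : ℝ) + q.exitRate x (s.toNNReal + v)) (hgm.const_add _)
    (fun s => add_nonneg α.2 (q.exitRate_nonneg _ _)) (C := α + C)
    (fun s => by linarith [hC (s.toNNReal + v)])
  refine le_trans ?_ hmain
  rw [jumpPart_univ, lintegral_leb]
  swap
  · exact ((q.measurable_density α).comp (by fun_prop :
      Measurable fun t : ℝ≥0 => (((v, x) : ℝ≥0 × S), t))).mul
      (q.measurable_exitRate.comp (by fun_prop :
        Measurable fun t : ℝ≥0 => (x, t))).ennreal_ofReal
  set F : ℝ → ℝ≥0∞ := (Ioi (0 : ℝ)).indicator fun t => ENNReal.ofReal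
    (Real.exp (-∫ s in (0 : ℝ)..t, ((α : ℝ) + q.exitRate x (s.toNNReal + v))) *
      ((α : ℝ) + q.exitRate x (t.toNNReal + v))) with hF
  calc _ ≤ ∫⁻ t in Ici (0 : ℝ), F (t - v) := by
        refine setLIntegral_mono' measurableSet_Ici fun t ht => ?_
        by_cases hvt : v < t.toNNReal
        · have hvt' : (v : ℝ) < t := by rwa [Real.lt_toNNReal_iff_coe_lt] at hvt
          have hpos : 0 < t - v := by linarith
          have he : (((t.toNNReal - v : ℝ≥0)) : ℝ) = t - v := by
            rw [NNReal.coe_sub hvt.le, Real.coe_toNNReal _ ht]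
          have ht' : (t - v).toNNReal + v = t.toNNReal := by
            apply NNReal.eq
            rw [NNReal.coe_add, Real.coe_toNNReal _ hpos.le, Real.coe_toNNReal _ ht]
            ring
          rw [hF, indicator_of_mem (mem_Ioi.2 hpos), if_pos hvt, ht',
            ENNReal.ofReal_mul (Real.exp_pos _).le,
            intervalIntegral.integral_add intervalIntegrable_const (hgi _)]
          refine mul_le_mul' (le_of_eq ?_) (ENNReal.ofReal_le_ofReal (by
            linarith [α.2, show (0 : ℝ) ≤ α from α.2]))
          simp only [survival, he, ENNReal.ofReal, intervalIntegral.integral_const, smul_eq_mul]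
          congr 3
          ring
        · simp [hvt]
    _ ≤ ∫⁻ t, F (t - v) := setLIntegral_le_lintegral _ _
    _ = ∫⁻ t, F t := lintegral_sub_right_eq_self F (v : ℝ)
    _ = _ := lintegral_indicator measurableSet_Ioi _

end QFunction

/-- The state space `([0,∞) × S) ∪ {(∞, Δ)}` of the pairs (jump time, post-jump state); the
isolated cemetery point `(∞, Δ)` is `Sum.inr ()`. -/
abbrev MarkedState (S : Type*) := (ℝ≥0 × S) ⊕ Unit

/-- The cemetery point `(∞, Δ)`. -/
def cemetery (S : Type*) : MarkedState S := Sum.inr ()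

/-- The time component in `[0,∞]` of a marked state. -/
noncomputable def MarkedState.time {S : Type*} : MarkedState S → ℝ≥0∞ :=
  Sum.elim (fun p => (p.1 : ℝ≥0∞)) fun _ => ∞

namespace QFunction

variable {S : Type*} [MeasurableSpace S] [StandardBorelSpace S] (q : QFunction S)

/-- The transition probability `p^α` on `([0,∞) × S) ∪ {(∞, Δ)}`: out of `(v, x)` it is
`jumpPart` on `[0,∞) × S`, with the remaining mass at the absorbing cemetery. -/
noncomputable def stepKernel (α : ℝ≥0) : Kernel (MarkedState S) (MarkedState S) where
  toFun := Sum.elim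
    (fun p => (q.jumpPart α p).map Sum.inl +
      (1 - q.jumpPart α p univ) • Measure.dirac (cemetery S))
    (fun _ => Measure.dirac (cemetery S))
  measurable' := by
    refine measurable_fun_sum ?_ measurable_const
    refine Measure.measurable_of_measurable_coe _ fun A hA => ?_
    have h1 : Measurable fun p => (q.jumpPart α p).map Sum.inl A := by
      simp_rw [Measure.map_apply (measurable_inl (α := ℝ≥0 × S) (β := Unit)) hA]
      exact Kernel.measurable_coe _ (measurable_inl hA)
    have h2 : Measurable fun p => q.jumpPart α p univ :=
      Kernel.measurable_coe _ MeasurableSet.univ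
    have h3 := h1.add ((measurable_const (a := (1 : ℝ≥0∞))).sub h2 |>.mul_const
      (Measure.dirac (cemetery S) A))
    simpa [Function.comp_def, Pi.add_def] using h3

instance (α : ℝ≥0) : IsMarkovKernel (q.stepKernel α) := by
  refine ⟨fun z => ⟨?_⟩⟩
  rcases z with p | u
  · have h : q.stepKernel α (Sum.inl p) = (q.jumpPart α p).map Sum.inl +
      (1 - q.jumpPart α p univ) • Measure.dirac (cemetery S) := rfl
    rw [h]
    simp [Measure.map_apply measurable_inl MeasurableSet.univ,
      add_tsub_cancel_of_le (q.jumpPart_univ_le_one α p)]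
  · have h : q.stepKernel α (Sum.inr u) = Measure.dirac (cemetery S) := rfl
    rw [h]
    simp

/-- The law `ℙ_x^q` of the marked point process `(t_n, x_n)` of jump times and post-jump states of
the pure jump process with `Q`-function `q` started from `x` at time `0`. Given
`(t_n, x_n) = (v, x)`, the pair `(t_{n+1}, x_{n+1})` has the (sub-)density
`exp (-∫_v^t q_x(s) ds) q̃(dy | x, t) dt` on `(v,∞) × S`, and with the remaining probability there
is no further jump (`t_{n+1} = ∞`). This is the kernel `p^α` with `α = 0`. -/
noncomputable def jumpLaw (x : S) : Measure (ℕ → MarkedState S) :=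
  chainLaw (q.stepKernel 0) (Sum.inl (0, x))

/-- Nonexplosion: `ℙ_x^q (t_∞ = ∞) = 1` for all `x`, where `t_∞ = sup_n t_n`. -/
def Nonexplosive : Prop :=
  ∀ x : S, q.jumpLaw x {ω | ⨆ n, (ω n).time = ∞} = 1

/-- `U` is a `[0,1]`-valued measurable solution on `[0,∞) × S` of
`U(v,x) = ∫₀^∞ ∫_S U(v+t,y) q̃(dy | x,v+t) exp (-α t - ∫₀ᵗ q_x(s+v) ds) dt`. -/
def IsUnitSolution (α : ℝ≥0) (U : ℝ≥0 × S → ℝ≥0∞) : Prop :=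
  Measurable U ∧ (∀ p, U p ≤ 1) ∧ ∀ (v : ℝ≥0) (x : S),
    U (v, x) = ∫⁻ t, (∫⁻ y, U (v + t, y) ∂q.jumpRates (x, v + t)) * q.survival α v x t ∂leb

end QFunction

end PureJump

/-!
For `α > 0` let `K_α` be the sub-Markov kernel `jumpPart α`, the part of `p^α` that does not lead to
the cemetery. Everything is compared with one function, the decreasing limit
`U_α = lim K_α ^ n 1` (`explosionTransform`): nonexplosion, Harris recurrence and uniqueness for the
integral equation are each equivalent to `U_α = 0`.

* The integral equation says `U = K_α U` (`isUnitSolution_iff`, a translation of Lebesgue measure),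
  and `U_α` is its largest solution with values in `[0,1]`
  (`not_exists_isUnitSolution_iff`).
* `K_α ^ n 1` is the probability that the chain of `p^α` has not been absorbed after `n` steps, so
  `U_α = 0` means almost sure absorption from every state. As jump times strictly increase, the
  chain never returns to a point outside the cemetery, and recurrence of the sets
  `{p, cemetery}` amounts to absorption (`isHarrisRecurrent_iff`).
* Killing at rate `α` amounts to discounting the jump times of the unkilled process
  (`kernelOp_jumpPart_zero_discount`), whence `K_α ^ n 1 (0, x) = E_x[exp (-α t_n)]` and
  `U_α (0, x) = E_x[exp (-α t_∞)]`. This vanishes if and only if `t_∞ = ∞` almost surely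
  (`nonexplosive_iff_explosionTransform`).

Nonexplosion only concerns starts at time `0`. It suffices for `U_α = 0` at all `(v, x)`: since exit
rates are bounded in time, the process started from `(0, x)` is still in `x` at time `v` with
positive probability (`explosionTransform_eq_zero_iff`).
-/

namespace PureJump

/-! ### Homogeneous Markov chains -/

section Chain

variable {E : Type*} [MeasurableSpace E]

/-- The action `f ↦ ∫ f(y) η(·, dy)` of a kernel on nonnegative functions. -/
noncomputable def kernelOp (η : Kernel E E) (f : E → ℝ≥0∞) : E → ℝ≥0∞ :=
  fun x => ∫⁻ y, f y ∂η x

lemma measurable_kernelOp (η : Kernel E E) {f : E → ℝ≥0∞} (hf : Measurable f) :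
    Measurable (kernelOp η f) :=
  hf.lintegral_kernel

lemma measurable_kernelOp_iterate (η : Kernel E E) {f : E → ℝ≥0∞} (hf : Measurable f) (n : ℕ) :
    Measurable ((kernelOp η)^[n] f) := by
  induction n with
  | zero => exact hf
  | succ n ih =>
    rw [Function.iterate_succ_apply']
    exact measurable_kernelOp η ih

lemma kernelOp_mono (η : Kernel E E) : Monotone (kernelOp η) :=
  fun _ _ h _ => lintegral_mono h

lemma measurableSet_frequently_mem {A : Set E}
    (hA : MeasurableSet A) : MeasurableSet {ω : ℕ → E | ∃ᶠ n in atTop, ω n ∈ A} := by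
  simp only [frequently_atTop]
  measurability

variable (κ : Kernel E E) [IsMarkovKernel κ] (x : E)

instance : IsProbabilityMeasure (chainLaw κ x) := by
  unfold chainLaw; infer_instance

/-- The joint law of two consecutive states of the chain. -/
lemma lintegral_chainLaw_pair (n : ℕ) {g : E × E → ℝ≥0∞} (hg : Measurable g) :
    ∫⁻ ω, g (ω n, ω (n + 1)) ∂chainLaw κ x =
      ∫⁻ ω, ∫⁻ y, g (ω n, y) ∂κ (ω n) ∂chainLaw κ x := by
  set η : (n : ℕ) → Kernel ((i : Finset.Iic n) → E) E := fun n =>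
    κ.comap (fun h : ((i : Finset.Iic n) → E) => h ⟨n, Finset.mem_Iic.2 le_rfl⟩)
      (measurable_pi_apply _) with hη
  have key := Kernel.partialTraj_compProd_eq_map_traj (X := fun _ => E) (κ := η) (Nat.zero_le n)
    (x₀ := fun _ => x)
  have hlast : Measurable fun h : ((i : Finset.Iic n) → E) =>
      h ⟨n, Finset.mem_Iic.2 le_rfl⟩ := measurable_pi_apply _
  have hG : Measurable fun p : ((i : Finset.Iic n) → E) × E =>
      g (p.1 ⟨n, Finset.mem_Iic.2 le_rfl⟩, p.2) :=
    hg.comp ((hlast.comp measurable_fst).prodMk measurable_snd)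
  have hf : Measurable fun y : E × E => g (y.1, y.2) := hg
  have hinner : Measurable fun y : E => ∫⁻ z, g (y, z) ∂κ y :=
    Measurable.lintegral_kernel_prod_right (κ := κ) hf
  have h1 := congrArg (fun μ => ∫⁻ p, g (p.1 ⟨n, Finset.mem_Iic.2 le_rfl⟩, p.2) ∂μ) key
  rw [Measure.lintegral_compProd hG, lintegral_map hG (by fun_prop),
    ← Kernel.traj_map_frestrictLe_apply] at h1
  exact h1.symm.trans (lintegral_map (hinner.comp hlast) (by fun_prop))

lemma lintegral_chainLaw_zero {f : E → ℝ≥0∞} (hf : Measurable f) :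
    ∫⁻ ω, f (ω 0) ∂chainLaw κ x = f x := by
  rw [chainLaw, Kernel.lintegral_traj (X := fun _ => E) (f := fun ω => f (ω 0)) _ (by fun_prop)]
  simp [Function.updateFinset]

lemma lintegral_chainLaw (n : ℕ) {f : E → ℝ≥0∞} (hf : Measurable f) :
    ∫⁻ ω, f (ω n) ∂chainLaw κ x = (kernelOp κ)^[n] f x := by
  induction n generalizing f with
  | zero => exact lintegral_chainLaw_zero κ x hf
  | succ n ih =>
    rw [lintegral_chainLaw_pair κ x n (g := fun p => f p.2) (by fun_prop),
      Function.iterate_succ_apply]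
    exact ih (measurable_kernelOp κ hf)

lemma ae_chainLaw_zero {A : Set E} (hA : MeasurableSet A) (hx : x ∈ A) :
    ∀ᵐ ω ∂chainLaw κ x, ω 0 ∈ A := by
  have h := lintegral_chainLaw_zero κ x (measurable_one.indicator hA.compl)
  rw [indicator_of_notMem (by simpa using hx)] at h
  filter_upwards [(lintegral_eq_zero_iff
    ((measurable_one.indicator hA.compl).comp (measurable_pi_apply 0))).1 h] with ω hω
  simpa using hω

/-- A relation between consecutive states that holds almost surely for one step of the chain
holds almost surely along the whole chain. -/
lemma ae_chainLaw_pair {R : Set (E × E)} (hR : MeasurableSet R)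
    (h : ∀ z, ∀ᵐ y ∂κ z, (z, y) ∈ R) :
    ∀ᵐ ω ∂chainLaw κ x, ∀ n, (ω n, ω (n + 1)) ∈ R := by
  refine ae_all_iff.2 fun n => ?_
  have hm : Measurable (Rᶜ.indicator (1 : E × E → ℝ≥0∞)) := measurable_one.indicator hR.compl
  have h0 := lintegral_chainLaw_pair κ x n hm
  have hz : ∀ z, ∫⁻ y, Rᶜ.indicator (1 : E × E → ℝ≥0∞) (z, y) ∂κ z = 0 := fun z => by
    refine (lintegral_eq_zero_iff (hm.comp measurable_prodMk_left)).2 ?_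
    filter_upwards [h z] with y hy
    simpa using hy
  simp only [hz, lintegral_zero] at h0
  filter_upwards [(lintegral_eq_zero_iff (hm.comp (by fun_prop :
    Measurable fun ω : ℕ → E => (ω n, ω (n + 1))))).1 h0] with ω hω
  simpa using hω

end Chain

/-! ### Lebesgue measure on the half-line -/

section Lebesgue

lemma lintegral_leb_translate (v : ℝ≥0) {f : ℝ≥0 → ℝ≥0∞} (hf : Measurable f) :
    ∫⁻ t, (Ioi v).indicator f t ∂leb = ∫⁻ t, f (v + t) ∂leb := by
  rw [lintegral_leb (hf.indicator measurableSet_Ioi), lintegral_leb (by fun_prop)]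
  set G : ℝ → ℝ≥0∞ := (Ioi (v : ℝ)).indicator fun t => f t.toNNReal with hG
  calc _ = ∫⁻ t in Ici (0 : ℝ), G t := by
        refine setLIntegral_congr_fun measurableSet_Ici fun t _ => ?_
        simp only [hG, indicator, mem_Ioi, Real.lt_toNNReal_iff_coe_lt]
    _ = ∫⁻ t, G t := by
        rw [← lintegral_indicator measurableSet_Ici]
        congr 1
        refine indicator_eq_self.2 fun t ht => ?_
        have : t ∈ Ioi (v : ℝ) := mem_of_indicator_ne_zero ht
        exact v.2.trans (le_of_lt this)
    _ = ∫⁻ t, G (t + v) := (lintegral_add_right_eq_self G (v : ℝ)).symm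
    _ = ∫⁻ t in Ioi (0 : ℝ), f (v + t.toNNReal) := by
        rw [← lintegral_indicator measurableSet_Ioi]
        congr 1
        ext t
        by_cases ht : 0 < t
        · have : (t + v).toNNReal = v + t.toNNReal := by
            rw [Real.toNNReal_add ht.le v.coe_nonneg, Real.toNNReal_coe, add_comm]
          simp [hG, ht, this]
        · simp [hG, ht]
    _ = _ := setLIntegral_congr Ioi_ae_eq_Ici

instance : NullSingletonClass leb := by
  refine ⟨fun t => ?_⟩
  rw [leb, Measure.map_apply measurable_real_toNNReal (measurableSet_singleton t)]
  refine measure_mono_null (t := {(t : ℝ)} ∪ (Ici 0)ᶜ) (fun s hs => ?_) ?_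
  · by_cases h0 : 0 ≤ s
    · left
      rw [mem_preimage, mem_singleton_iff] at hs
      rw [← hs, Real.coe_toNNReal _ h0]
      rfl
    · exact Or.inr h0
  · refine measure_union_null (by simp) ?_
    rw [Measure.restrict_apply measurableSet_Ici.compl, compl_inter_self, measure_empty]

end Lebesgue

/-! ### Discounting and marked states -/

section Discount

/-- The discount factor `exp (-α t)`. -/
noncomputable def discount (α t : ℝ≥0) : ℝ≥0∞ := ENNReal.ofReal (Real.exp (-(α * t : ℝ)))

lemma measurable_discount (α : ℝ≥0) : Measurable (discount α) := by
  unfold discount; fun_prop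

lemma discount_add (α s t : ℝ≥0) : discount α (s + t) = discount α s * discount α t := by
  unfold discount
  rw [← ENNReal.ofReal_mul (Real.exp_pos _).le, ← Real.exp_add, NNReal.coe_add]
  congr 2
  ring

lemma discount_zero (α : ℝ≥0) : discount α 0 = 1 := by simp [discount]

lemma discount_pos (α t : ℝ≥0) : 0 < discount α t := ENNReal.ofReal_pos.2 (Real.exp_pos _)

lemma antitone_discount (α : ℝ≥0) : Antitone (discount α) := fun _ _ h =>
  ENNReal.ofReal_le_ofReal (Real.exp_le_exp.2 (neg_le_neg
    (mul_le_mul_of_nonneg_left (NNReal.coe_le_coe.2 h) α.coe_nonneg)))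

lemma tendsto_discount {α : ℝ≥0} (hα : 0 < α) : Tendsto (discount α) atTop (nhds 0) := by
  unfold discount
  rw [← ENNReal.ofReal_zero]
  refine ENNReal.tendsto_ofReal (Real.tendsto_exp_neg_atTop_nhds_zero.comp ?_)
  exact (NNReal.tendsto_coe_atTop.2 tendsto_id).const_mul_atTop (NNReal.coe_pos.2 hα)

end Discount

section MarkedState

lemma time_eq_top_iff {S : Type*} (z : MarkedState S) : z.time = ∞ ↔ z = cemetery S := by
  rcases z with p | u
  · simp [MarkedState.time, cemetery]
  · simp [MarkedState.time, cemetery]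

variable {S : Type*}

/-- The discounted jump times have infimum zero exactly on nonexploding paths. -/
lemma iInf_discount_eq_zero_iff {α : ℝ≥0} (hα : 0 < α) (ω : ℕ → MarkedState S) :
    ⨅ n, Sum.elim (fun p : ℝ≥0 × S => discount α p.1) (0 : Unit → ℝ≥0∞) (ω n) = 0 ↔
      ⨆ n, (ω n).time = ∞ := by
  constructor
  · intro h
    refine iSup_eq_top.2 fun b hb => ?_
    lift b to ℝ≥0 using hb.ne
    obtain ⟨n, hn⟩ := iInf_eq_bot.1 h (discount α b) (discount_pos α b)
    refine ⟨n, ?_⟩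
    rcases hωn : ω n with p | u
    · rw [hωn] at hn
      exact ENNReal.coe_lt_coe.2 (lt_of_not_ge fun hle => (antitone_discount α hle).not_gt hn)
    · exact ENNReal.coe_lt_top
  · intro h
    refine iInf_eq_bot.2 fun ε hε => ?_
    obtain ⟨b, hb⟩ := ((tendsto_discount hα).eventually_lt_const hε).exists
    obtain ⟨n, hn⟩ := iSup_eq_top.1 h b ENNReal.coe_lt_top
    refine ⟨n, ?_⟩
    rcases hωn : ω n with p | u
    · rw [hωn] at hn
      exact (antitone_discount α (ENNReal.coe_lt_coe.1 hn).le).trans_lt hb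
    · exact hε

/-- The indicator of `[0,∞) × S` along a path has infimum zero exactly on absorbed paths. -/
lemma iInf_alive_eq_zero_iff (ω : ℕ → MarkedState S) :
    ⨅ n, Sum.elim (1 : ℝ≥0 × S → ℝ≥0∞) (0 : Unit → ℝ≥0∞) (ω n) = 0 ↔
      ∃ n, ω n = cemetery S := by
  constructor
  · intro h
    obtain ⟨n, hn⟩ := iInf_eq_bot.1 h 1 one_pos
    refine ⟨n, ?_⟩
    rcases hωn : ω n with p | u
    · simp [hωn] at hn
    · rfl
  · rintro ⟨n, hn⟩
    exact le_antisymm (iInf_le_of_le n (by simp [hn, cemetery])) zero_le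

variable [MeasurableSpace S]

lemma measurable_time : Measurable (MarkedState.time (S := S)) :=
  (measurable_fst.coe_nnreal_ennreal).sumElim measurable_const

lemma measurableSet_cemetery : MeasurableSet {cemetery S} := by
  convert measurable_time (S := S) (measurableSet_singleton ∞)
  ext z
  exact (time_eq_top_iff z).symm

end MarkedState

namespace QFunction

section Survival

variable {S : Type*} [MeasurableSpace S] (q : QFunction S)

lemma survival_pos (α v : ℝ≥0) (x : S) (t : ℝ≥0) : 0 < q.survival α v x t :=
  Real.toNNReal_pos.2 (Real.exp_pos _)

lemma survival_eq_discount_mul (α v : ℝ≥0) (x : S) (t : ℝ≥0) :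
    (q.survival α v x t : ℝ≥0∞) = discount α t * q.survival 0 v x t := by
  unfold survival discount
  change ENNReal.ofReal _ = _ * ENNReal.ofReal _
  rw [← ENNReal.ofReal_mul (Real.exp_pos _).le, ← Real.exp_add]
  congr 2
  simp [sub_eq_add_neg]

end Survival

/-! ### Transition probabilities of the killed process -/

variable {S : Type*} [MeasurableSpace S] [StandardBorelSpace S] (q : QFunction S)

/-- Integration against `jumpPart` in terms of the holding time, the time from `v` to the next
jump. -/
lemma lintegral_jumpPart (α v : ℝ≥0) (x : S) {f : ℝ≥0 × S → ℝ≥0∞} (hf : Measurable f) :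
    ∫⁻ z, f z ∂q.jumpPart α (v, x) =
      ∫⁻ t, q.survival α v x t * ∫⁻ y, f (v + t, y) ∂q.jumpRates (x, v + t) ∂leb := by
  have hsurv : Measurable fun t : ℝ≥0 => q.survival α v x t :=
    (q.measurable_survival α).comp (by fun_prop :
      Measurable fun t : ℝ≥0 => (((v, x) : ℝ≥0 × S), t))
  have hinner : Measurable fun t : ℝ≥0 => ∫⁻ y, f (t, y) ∂q.jumpRates (x, t) :=
    Measurable.lintegral_kernel_prod_right
      (κ := q.jumpRates.comap (fun t : ℝ≥0 => (x, t)) (by fun_prop)) (f := fun t y => f (t, y)) hf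
  have hd : Measurable fun t : ℝ≥0 => (q.survival α v x (t - v) : ℝ≥0∞) :=
    (hsurv.comp (by fun_prop : Measurable fun t : ℝ≥0 => t - v)).coe_nnreal_ennreal
  have htr := lintegral_leb_translate v
    (f := fun t => q.survival α v x (t - v) * ∫⁻ y, f (t, y) ∂q.jumpRates (x, t))
    (hd.mul hinner)
  simp only [add_tsub_cancel_left] at htr
  rw [← htr, jumpPart, Kernel.lintegral_compProd _ _ _ hf]
  simp only [Kernel.comap_apply]
  rw [Kernel.lintegral_withDensity _ (q.measurable_density α) _ hinner, Kernel.const_apply]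
  refine lintegral_congr fun t => ?_
  by_cases ht : v < t <;> simp [ht]

lemma isUnitSolution_iff (α : ℝ≥0) (U : ℝ≥0 × S → ℝ≥0∞) : q.IsUnitSolution α U ↔
    Measurable U ∧ (∀ p, U p ≤ 1) ∧ kernelOp (q.jumpPart α) U = U := by
  refine and_congr_right fun hU => and_congr_right fun _ => ?_
  have h : ∀ v x, kernelOp (q.jumpPart α) U (v, x) =
      ∫⁻ t, (∫⁻ y, U (v + t, y) ∂q.jumpRates (x, v + t)) * q.survival α v x t ∂leb := fun v x => by
    rw [kernelOp, q.lintegral_jumpPart α v x hU]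
    simp only [mul_comm]
  constructor
  · intro heq
    ext ⟨v, x⟩
    rw [h, ← heq]
  · intro heq v x
    rw [← h, heq]

lemma survival_add (α v : ℝ≥0) (x : S) (s t : ℝ≥0) :
    q.survival α v x (s + t) = q.survival α v x s * q.survival α (v + s) x t := by
  obtain ⟨C, hC⟩ := q.exists_exitRate_le x
  have hi : ∀ a b : ℝ, IntervalIntegrable (fun r : ℝ => q.exitRate x (r.toNNReal + v))
      volume a b := fun a b => by
    refine (intervalIntegrable_const (c := C)).mono_fun (q.measurable_exitRate.comp (by fun_prop :
      Measurable fun r : ℝ => (x, r.toNNReal + v))).aestronglyMeasurable ?_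
    filter_upwards with r
    rw [Real.norm_of_nonneg (q.exitRate_nonneg _ _),
      Real.norm_of_nonneg ((q.exitRate_nonneg x 0).trans (hC 0))]
    exact hC _
  have hshift : ∫ r in (0 : ℝ)..t, q.exitRate x (r.toNNReal + (v + s)) =
      ∫ r in (s : ℝ)..(s + t), q.exitRate x (r.toNNReal + v) := by
    have h := intervalIntegral.integral_comp_add_right (a := 0) (b := (t : ℝ))
      (fun r : ℝ => q.exitRate x (r.toNNReal + v)) (s : ℝ)
    rw [zero_add, add_comm (t : ℝ)] at h
    rw [← h]
    refine intervalIntegral.integral_congr fun r hr => ?_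
    rw [uIcc_of_le t.coe_nonneg] at hr
    rw [Real.toNNReal_add hr.1 s.coe_nonneg, Real.toNNReal_coe, add_assoc, add_comm s v]
  unfold survival
  rw [← Real.toNNReal_mul (Real.exp_pos _).le, ← Real.exp_add, hshift, NNReal.coe_add,
    ← intervalIntegral.integral_add_adjacent_intervals (hi 0 s) (hi s (s + t))]
  congr 2
  ring

/-- With probability `survival α v x s` the process is neither killed nor leaves `x` during
`(v, v + s]`, and then it goes on as the process started from `x` at time `v + s`. -/
lemma survival_mul_kernelOp_le (α v : ℝ≥0) (x : S) (s : ℝ≥0) {f : ℝ≥0 × S → ℝ≥0∞}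
    (hf : Measurable f) :
    q.survival α v x s * kernelOp (q.jumpPart α) f (v + s, x) ≤
      kernelOp (q.jumpPart α) f (v, x) := by
  have hsurv : Measurable fun t : ℝ≥0 => q.survival α v x t :=
    (q.measurable_survival α).comp (by fun_prop :
      Measurable fun t : ℝ≥0 => (((v, x) : ℝ≥0 × S), t))
  have hinner : Measurable fun t : ℝ≥0 => ∫⁻ y, f (v + t, y) ∂q.jumpRates (x, v + t) :=
    Measurable.lintegral_kernel_prod_right
      (κ := q.jumpRates.comap (fun t : ℝ≥0 => (x, v + t)) (by fun_prop))
      (f := fun t y => f (v + t, y)) (by fun_prop)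
  have hF : Measurable fun t : ℝ≥0 =>
      (q.survival α v x t : ℝ≥0∞) * ∫⁻ y, f (v + t, y) ∂q.jumpRates (x, v + t) :=
    hsurv.coe_nnreal_ennreal.mul hinner
  rw [kernelOp, kernelOp, q.lintegral_jumpPart α _ x hf, q.lintegral_jumpPart α v x hf,
    ← lintegral_const_mul' _ _ ENNReal.coe_ne_top]
  calc _ = ∫⁻ t, q.survival α v x (s + t) *
          ∫⁻ y, f (v + (s + t), y) ∂q.jumpRates (x, v + (s + t)) ∂leb := by
        refine lintegral_congr fun t => ?_
        rw [survival_add, ENNReal.coe_mul, mul_assoc, add_assoc]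
    _ = ∫⁻ t, (Ioi s).indicator (fun t => (q.survival α v x t : ℝ≥0∞) *
          ∫⁻ y, f (v + t, y) ∂q.jumpRates (x, v + t)) t ∂leb :=
        (lintegral_leb_translate s hF).symm
    _ ≤ _ := lintegral_mono fun t => indicator_le_self _ _ t

/-- Killing at rate `α` is the same as discounting the jump times at rate `α`. -/
lemma kernelOp_jumpPart_zero_discount (α : ℝ≥0) {f : ℝ≥0 × S → ℝ≥0∞} (hf : Measurable f) :
    kernelOp (q.jumpPart 0) (fun p => discount α p.1 * f p) =
      fun p => discount α p.1 * kernelOp (q.jumpPart α) f p := by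
  ext ⟨v, x⟩
  have hg : Measurable fun p : ℝ≥0 × S => discount α p.1 * f p :=
    ((measurable_discount α).comp measurable_fst).mul hf
  have hfin : ∀ t, discount α t ≠ ∞ := fun t => ENNReal.ofReal_ne_top
  rw [kernelOp, kernelOp, q.lintegral_jumpPart 0 v x hg, q.lintegral_jumpPart α v x hf,
    ← lintegral_const_mul' _ _ (hfin v)]
  refine lintegral_congr fun t => ?_
  rw [lintegral_const_mul' _ _ (hfin _), discount_add, q.survival_eq_discount_mul α]
  ring

lemma kernelOp_jumpPart_zero_iterate_discount (α : ℝ≥0) {f : ℝ≥0 × S → ℝ≥0∞} (hf : Measurable f)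
    (n : ℕ) :
    (kernelOp (q.jumpPart 0))^[n] (fun p => discount α p.1 * f p) =
      fun p => discount α p.1 * (kernelOp (q.jumpPart α))^[n] f p := by
  induction n with
  | zero => rfl
  | succ n ih =>
    rw [Function.iterate_succ_apply', ih, q.kernelOp_jumpPart_zero_discount α
      (measurable_kernelOp_iterate _ hf n), Function.iterate_succ_apply']

lemma ae_jumpPart_of_ae_leb (α v : ℝ≥0) (x : S) {A : Set ℝ≥0} (hA : MeasurableSet A)
    (h : ∀ᵐ t ∂leb, v + t ∈ A) : ∀ᵐ z ∂q.jumpPart α (v, x), z.1 ∈ A := by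
  have hm : Measurable fun z : ℝ≥0 × S => Aᶜ.indicator (1 : ℝ≥0 → ℝ≥0∞) z.1 :=
    (measurable_one.indicator hA.compl).comp measurable_fst
  have h0 : ∫⁻ z, Aᶜ.indicator (1 : ℝ≥0 → ℝ≥0∞) z.1 ∂q.jumpPart α (v, x) = 0 := by
    rw [q.lintegral_jumpPart α v x hm]
    refine (lintegral_congr_ae ?_).trans lintegral_zero
    filter_upwards [h] with t ht
    simp [ht]
  filter_upwards [(lintegral_eq_zero_iff hm).1 h0] with z hz
  simpa using hz

lemma ae_lt_jumpPart (α : ℝ≥0) (p : ℝ≥0 × S) : ∀ᵐ z ∂q.jumpPart α p, p.1 < z.1 := by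
  refine q.ae_jumpPart_of_ae_leb α p.1 p.2 measurableSet_Ioi ?_
  filter_upwards [compl_mem_ae_iff.2 (measure_singleton (μ := leb) 0)] with t ht
  exact lt_add_of_pos_right _ (pos_iff_ne_zero.2 ht)

/-! ### The transition probability on marked states -/

lemma stepKernel_inl (α : ℝ≥0) (p : ℝ≥0 × S) :
    q.stepKernel α (Sum.inl p) = (q.jumpPart α p).map Sum.inl +
      (1 - q.jumpPart α p univ) • Measure.dirac (cemetery S) := rfl

lemma stepKernel_inr (α : ℝ≥0) (u : Unit) :
    q.stepKernel α (Sum.inr u) = Measure.dirac (cemetery S) := rfl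

lemma ae_stepKernel_inl (α : ℝ≥0) (p : ℝ≥0 × S) {A : Set (MarkedState S)} (hA : MeasurableSet A)
    (hp : ∀ᵐ z ∂q.jumpPart α p, Sum.inl z ∈ A) (hc : cemetery S ∈ A) :
    ∀ᵐ z ∂q.stepKernel α (Sum.inl p), z ∈ A := by
  rw [stepKernel_inl, ae_add_measure_iff]
  refine ⟨(ae_map_iff measurable_inl.aemeasurable hA).2 hp, Measure.ae_smul_measure ?_ _⟩
  exact (ae_dirac_iff hA).2 hc

/-- Jump times are strictly increasing as long as they are finite. -/
lemma ae_time_stepKernel (α : ℝ≥0) (z : MarkedState S) :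
    ∀ᵐ z' ∂q.stepKernel α z, z.time < z'.time ∨ z'.time = ∞ := by
  have hA : MeasurableSet {z' : MarkedState S | z.time < z'.time ∨ z'.time = ∞} :=
    (measurableSet_lt measurable_const measurable_time).union
      (measurable_time (measurableSet_singleton _))
  rcases z with p | u
  · refine q.ae_stepKernel_inl α p hA ?_ (Or.inr rfl)
    filter_upwards [q.ae_lt_jumpPart α p] with z hz
    exact Or.inl (ENNReal.coe_lt_coe.2 hz)
  · rw [stepKernel_inr]
    exact (ae_dirac_iff hA).2 (Or.inr rfl)

lemma ae_time_chainLaw (α : ℝ≥0) (z : MarkedState S) :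
    ∀ᵐ ω ∂chainLaw (q.stepKernel α) z,
      ∀ n, (ω n).time < (ω (n + 1)).time ∨ (ω (n + 1)).time = ∞ :=
  ae_chainLaw_pair _ z (R := {w | w.1.time < w.2.time ∨ w.2.time = ∞})
    ((measurableSet_lt (measurable_time.comp measurable_fst)
      (measurable_time.comp measurable_snd)).union
      ((measurable_time.comp measurable_snd) (measurableSet_singleton _)))
    (q.ae_time_stepKernel α)

lemma ae_monotone_time (α : ℝ≥0) (z : MarkedState S) :
    ∀ᵐ ω ∂chainLaw (q.stepKernel α) z, Monotone fun n => (ω n).time := by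
  filter_upwards [q.ae_time_chainLaw α z] with ω hω
  refine monotone_nat_of_le_succ fun n => ?_
  rcases hω n with h | h
  · exact h.le
  · exact h ▸ le_top

lemma kernelOp_stepKernel (α : ℝ≥0) {f : ℝ≥0 × S → ℝ≥0∞} (hf : Measurable f) :
    kernelOp (q.stepKernel α) (Sum.elim f 0) = Sum.elim (kernelOp (q.jumpPart α) f) 0 := by
  have hm : Measurable (Sum.elim f (0 : Unit → ℝ≥0∞)) := hf.sumElim measurable_zero
  ext z
  rcases z with p | u
  · rw [kernelOp, stepKernel_inl, lintegral_add_measure, lintegral_map hm measurable_inl,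
      lintegral_smul_measure, lintegral_dirac' _ hm]
    simp [cemetery, kernelOp]
  · rw [kernelOp, stepKernel_inr, lintegral_dirac' _ hm]
    rfl

lemma kernelOp_stepKernel_iterate (α : ℝ≥0) {f : ℝ≥0 × S → ℝ≥0∞} (hf : Measurable f) (n : ℕ) :
    (kernelOp (q.stepKernel α))^[n] (Sum.elim f 0) =
      Sum.elim ((kernelOp (q.jumpPart α))^[n] f) 0 := by
  induction n with
  | zero => rfl
  | succ n ih =>
    rw [Function.iterate_succ_apply', ih, q.kernelOp_stepKernel α
      (measurable_kernelOp_iterate _ hf n), Function.iterate_succ_apply']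

/-! ### The maximal solution of the integral equation -/

/-- The limit `E[exp (-α (t_∞ - v))]` of the `α`-discounted masses of `n` jumps out of `(v, x)`.
Equivalently, it is the probability that the process killed at rate `α` makes infinitely many
jumps. For `α > 0` it vanishes if and only if the process does not explode. -/
noncomputable def explosionTransform (α : ℝ≥0) (p : ℝ≥0 × S) : ℝ≥0∞ :=
  ⨅ n, (kernelOp (q.jumpPart α))^[n] 1 p

lemma kernelOp_one_le (α : ℝ≥0) : kernelOp (q.jumpPart α) 1 ≤ 1 := fun p => by
  simpa [kernelOp] using q.jumpPart_univ_le_one α p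

lemma antitone_kernelOp_iterate_one (α : ℝ≥0) :
    Antitone fun n => (kernelOp (q.jumpPart α))^[n] (1 : ℝ≥0 × S → ℝ≥0∞) :=
  (kernelOp_mono _).antitone_iterate_of_map_le (q.kernelOp_one_le α)

lemma isUnitSolution_explosionTransform (α : ℝ≥0) :
    q.IsUnitSolution α (q.explosionTransform α) := by
  have hm : ∀ n, Measurable ((kernelOp (q.jumpPart α))^[n] 1) :=
    measurable_kernelOp_iterate _ measurable_one
  refine (q.isUnitSolution_iff α _).2 ⟨.iInf hm, fun p => iInf_le _ 0, ?_⟩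
  ext p
  have hanti := q.antitone_kernelOp_iterate_one α
  have hfin : ∫⁻ z, (kernelOp (q.jumpPart α))^[0] 1 z ∂q.jumpPart α p ≠ ∞ :=
    ((q.kernelOp_one_le α p).trans_lt ENNReal.one_lt_top).ne
  calc ∫⁻ z, ⨅ n, (kernelOp (q.jumpPart α))^[n] 1 z ∂q.jumpPart α p
      = ⨅ n, ∫⁻ z, (kernelOp (q.jumpPart α))^[n] 1 z ∂q.jumpPart α p :=
        lintegral_iInf hm hanti hfin
    _ = ⨅ n, (kernelOp (q.jumpPart α))^[n + 1] 1 p := by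
        refine iInf_congr fun n => ?_
        rw [Function.iterate_succ_apply']
        rfl
    _ = ⨅ n, (kernelOp (q.jumpPart α))^[n] 1 p :=
        Antitone.iInf_nat_add (f := fun n => (kernelOp (q.jumpPart α))^[n] 1 p)
          (fun _ _ h => hanti h p) 1

/-- `explosionTransform` is the largest solution of the integral equation. -/
lemma IsUnitSolution.le_explosionTransform {α : ℝ≥0} {U : ℝ≥0 × S → ℝ≥0∞}
    (hU : q.IsUnitSolution α U) : U ≤ q.explosionTransform α := by
  obtain ⟨-, h1, hfix⟩ := (q.isUnitSolution_iff α U).1 hU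
  intro p
  refine le_iInf fun n => ?_
  calc U p = (kernelOp (q.jumpPart α))^[n] U p := by rw [Function.iterate_fixed hfix]
    _ ≤ _ := (kernelOp_mono _).iterate n (show U ≤ 1 from h1) p

lemma not_exists_isUnitSolution_iff (α : ℝ≥0) :
    (¬ ∃ U : ℝ≥0 × S → ℝ≥0∞, q.IsUnitSolution α U ∧ ∃ p, U p ≠ 0) ↔
      q.explosionTransform α = 0 := by
  refine ⟨fun h => ?_, fun h => ?_⟩
  · ext p
    by_contra hp
    exact h ⟨_, q.isUnitSolution_explosionTransform α, p, hp⟩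
  · rintro ⟨U, hU, p, hp⟩
    exact hp (le_antisymm ((hU.le_explosionTransform q p).trans_eq (congrFun h p)) zero_le)

/-- Explosion from `x` at a later time `v` would be seen from `x` at time `0`, since the process
stays in `x` up to time `v` with positive probability. -/
lemma explosionTransform_eq_zero_iff (α : ℝ≥0) :
    q.explosionTransform α = 0 ↔ ∀ x, q.explosionTransform α (0, x) = 0 := by
  refine ⟨fun h x => congrFun h _, fun h => ?_⟩
  obtain ⟨hm, -, hfix⟩ := (q.isUnitSolution_iff α _).1 (q.isUnitSolution_explosionTransform α)
  ext ⟨v, x⟩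
  have hle := q.survival_mul_kernelOp_le α 0 x v hm
  rw [hfix, h x, zero_add, nonpos_iff_eq_zero, mul_eq_zero] at hle
  exact hle.resolve_left (ENNReal.coe_ne_zero.2 (q.survival_pos α 0 x v).ne')

/-! ### Nonexplosion and Harris recurrence -/

/-- Monotone convergence along the chain for a function that decreases with time. -/
lemma lintegral_iInf_chainLaw (α : ℝ≥0) (z : MarkedState S) {h : MarkedState S → ℝ≥0∞}
    (hm : Measurable h) (hanti : ∀ z z', z.time ≤ z'.time → h z' ≤ h z) (hz : h z ≠ ∞) :
    ∫⁻ ω, ⨅ n, h (ω n) ∂chainLaw (q.stepKernel α) z =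
      ⨅ n, (kernelOp (q.stepKernel α))^[n] h z := by
  rw [lintegral_iInf_ae (f := fun n (ω : ℕ → MarkedState S) => h (ω n))
    (fun n => hm.comp (measurable_pi_apply n))]
  · exact iInf_congr fun n => lintegral_chainLaw _ z n hm
  · intro n
    filter_upwards [q.ae_monotone_time α z] with ω hω
    exact hanti _ _ (hω n.le_succ)
  · rwa [lintegral_chainLaw_zero _ z hm]

lemma nonexplosive_iff_explosionTransform {α : ℝ≥0} (hα : 0 < α) :
    q.Nonexplosive ↔ q.explosionTransform α = 0 := by
  rw [explosionTransform_eq_zero_iff]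
  refine forall_congr' fun x => ?_
  have hd : Measurable fun p : ℝ≥0 × S => discount α p.1 :=
    (measurable_discount α).comp measurable_fst
  have hm : Measurable (Sum.elim (fun p : ℝ≥0 × S => discount α p.1) (0 : Unit → ℝ≥0∞)) :=
    hd.sumElim measurable_zero
  have hanti : ∀ z z' : MarkedState S, z.time ≤ z'.time →
      Sum.elim (fun p : ℝ≥0 × S => discount α p.1) (0 : Unit → ℝ≥0∞) z' ≤
        Sum.elim (fun p : ℝ≥0 × S => discount α p.1) 0 z := by
    rintro (p | u) (p' | u') h
    · exact antitone_discount α (ENNReal.coe_le_coe.1 h)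
    · exact zero_le
    · exact absurd (top_le_iff.1 h) ENNReal.coe_ne_top
    · exact le_rfl
  have hU : ∫⁻ ω, ⨅ n, Sum.elim (fun p : ℝ≥0 × S => discount α p.1) (0 : Unit → ℝ≥0∞) (ω n)
      ∂q.jumpLaw x = q.explosionTransform α (0, x) := by
    rw [jumpLaw, q.lintegral_iInf_chainLaw 0 _ hm hanti (by simp [discount_zero])]
    refine iInf_congr fun n => ?_
    rw [q.kernelOp_stepKernel_iterate 0 hd]
    have := congrFun (q.kernelOp_jumpPart_zero_iterate_discount α measurable_one n) (0, x)
    simpa [discount_zero] using this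
  have : IsProbabilityMeasure (q.jumpLaw x) := by unfold jumpLaw; infer_instance
  have hset : MeasurableSet {ω : ℕ → MarkedState S | ⨆ n, (ω n).time = ∞} :=
    (Measurable.iSup fun n => measurable_time.comp (measurable_pi_apply n))
      (measurableSet_singleton _)
  rw [← hU, ← mem_ae_iff_prob_eq_one hset]
  refine Iff.trans ?_ (lintegral_eq_zero_iff
    (Measurable.iInf fun n => hm.comp (measurable_pi_apply n))).symm
  exact eventually_congr (ae_of_all _ fun ω => (iInf_discount_eq_zero_iff hα ω).symm)

/-- `explosionTransform` vanishes at `p` if and only if the killed chain started from `p` is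
absorbed almost surely. -/
lemma explosionTransform_eq_zero_iff_ae_absorbed (α : ℝ≥0) (p : ℝ≥0 × S) :
    q.explosionTransform α p = 0 ↔
      ∀ᵐ ω ∂chainLaw (q.stepKernel α) (Sum.inl p), ∃ n, ω n = cemetery S := by
  have hm : Measurable (Sum.elim (1 : ℝ≥0 × S → ℝ≥0∞) (0 : Unit → ℝ≥0∞)) :=
    measurable_one.sumElim measurable_zero
  have hanti : ∀ z z' : MarkedState S, z.time ≤ z'.time →
      Sum.elim (1 : ℝ≥0 × S → ℝ≥0∞) (0 : Unit → ℝ≥0∞) z' ≤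
        Sum.elim (1 : ℝ≥0 × S → ℝ≥0∞) (0 : Unit → ℝ≥0∞) z := by
    rintro (p | u) (p' | u') h
    · exact le_rfl
    · exact zero_le
    · exact absurd (top_le_iff.1 h) ENNReal.coe_ne_top
    · exact le_rfl
  have hU : ∫⁻ ω, ⨅ n, Sum.elim (1 : ℝ≥0 × S → ℝ≥0∞) (0 : Unit → ℝ≥0∞) (ω n)
      ∂chainLaw (q.stepKernel α) (Sum.inl p) = q.explosionTransform α p := by
    rw [q.lintegral_iInf_chainLaw α _ hm hanti (by simp)]
    refine iInf_congr fun n => ?_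
    rw [q.kernelOp_stepKernel_iterate α measurable_one]
    rfl
  rw [← hU]
  refine (lintegral_eq_zero_iff
    (Measurable.iInf fun n => hm.comp (measurable_pi_apply n))).trans ?_
  exact eventually_congr (ae_of_all _ fun ω => iInf_alive_eq_zero_iff ω)

lemma ae_eventually_eq_cemetery {α : ℝ≥0} (h : q.explosionTransform α = 0) (z : MarkedState S) :
    ∀ᵐ ω ∂chainLaw (q.stepKernel α) z, ∀ᶠ n in atTop, ω n = cemetery S := by
  have hhit : ∀ᵐ ω ∂chainLaw (q.stepKernel α) z, ∃ n, ω n = cemetery S := by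
    rcases z with p | u
    · exact (q.explosionTransform_eq_zero_iff_ae_absorbed α p).1 (congrFun h p)
    · filter_upwards [ae_chainLaw_zero (q.stepKernel α) (Sum.inr u) measurableSet_cemetery rfl]
        with ω hω
      exact ⟨0, hω⟩
  filter_upwards [hhit, q.ae_monotone_time α z] with ω ⟨n, hn⟩ hmono
  refine eventually_atTop.2 ⟨n, fun m hm => (time_eq_top_iff _).1 (top_le_iff.1 ?_)⟩
  rw [← (time_eq_top_iff _).2 hn]
  exact hmono hm

lemma isHarrisRecurrent_iff (α : ℝ≥0) :
    IsHarrisRecurrent (q.stepKernel α) (Measure.dirac (cemetery S)) ↔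
      q.explosionTransform α = 0 := by
  have hmem : ∀ A : Set (MarkedState S), MeasurableSet A →
      0 < Measure.dirac (cemetery S) A → cemetery S ∈ A := fun A hA h => by
    by_contra hc
    rw [Measure.dirac_apply' _ hA, indicator_of_notMem hc] at h
    exact h.ne rfl
  constructor
  · rintro ⟨-, hrec⟩
    ext p
    refine (q.explosionTransform_eq_zero_iff_ae_absorbed α p).2 ?_
    -- Recurrence says nothing about starting points outside the target set, so `p` is added to it;
    -- the chain never returns to `p`.
    have hA : MeasurableSet ({Sum.inl p} ∪ {cemetery S} : Set (MarkedState S)) := by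
      refine MeasurableSet.union ?_ measurableSet_cemetery
      rw [← image_singleton]
      exact (measurableSet_singleton p).inl_image
    have hfreq := (mem_ae_iff_prob_eq_one (measurableSet_frequently_mem hA)).2
      (hrec _ hA (by
        rw [Measure.dirac_apply_of_mem (show cemetery S ∈ _ from Or.inr rfl)]
        exact one_pos) (Sum.inl p)
        (Or.inl rfl))
    have h0 : ∀ᵐ ω ∂chainLaw (q.stepKernel α) (Sum.inl p),
        ω 0 ∈ MarkedState.time ⁻¹' {(p.1 : ℝ≥0∞)} :=
      ae_chainLaw_zero _ _ (measurable_time (measurableSet_singleton _)) rfl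
    filter_upwards [hfreq, h0, q.ae_time_chainLaw α (Sum.inl p),
      q.ae_monotone_time α (Sum.inl p)] with ω hω hω0 hstep hmono
    obtain ⟨n, hn, hωn⟩ := frequently_atTop.1 hω 1
    refine ⟨n, hωn.resolve_left fun heq => ?_⟩
    have htime : (ω n).time = (p.1 : ℝ≥0∞) := by rw [heq]; rfl
    have hle : (ω 1).time ≤ p.1 := htime ▸ hmono hn
    rcases hstep 0 with h | h
    · exact (h.trans_le hle).ne hω0
    · exact ENNReal.coe_ne_top (top_le_iff.1 (h ▸ hle))
  · intro h
    refine ⟨⟨⟨fun h0 => ?_, fun A hA hpos z => ?_⟩, fun φ hφ => ?_⟩, fun A hA hpos z _ => ?_⟩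
    · exact one_ne_zero ((measure_univ (μ := Measure.dirac (cemetery S))).symm.trans (by simp [h0]))
    · have hc := hmem A hA hpos
      have hae : ∀ᵐ ω ∂chainLaw (q.stepKernel α) z, ∃ n, 1 ≤ n ∧ ω n ∈ A := by
        filter_upwards [q.ae_eventually_eq_cemetery h z] with ω hω
        obtain ⟨n, hn, hn1⟩ := (hω.and (eventually_ge_atTop 1)).exists
        exact ⟨n, hn1, hn ▸ hc⟩
      exact pos_iff_ne_zero.2 fun h0 =>
        (hae.and (measure_eq_zero_iff_ae_notMem.1 h0)).exists.elim fun ω hω => hω.2 hω.1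
    · -- The chain started at the cemetery never leaves it, so that an irreducibility measure does
      -- not charge the complement.
      refine Measure.AbsolutelyContinuous.mk fun A hA hA0 => ?_
      by_contra hφA
      have hpos := hφ.2 A hA (pos_iff_ne_zero.2 hφA) (cemetery S)
      have hc : cemetery S ∉ A := fun hc => by
        rw [Measure.dirac_apply_of_mem hc] at hA0
        exact one_ne_zero hA0
      refine hpos.ne' (measure_eq_zero_iff_ae_notMem.2 ?_)
      filter_upwards [ae_chainLaw_zero (q.stepKernel α) (cemetery S) measurableSet_cemetery rfl,
        q.ae_monotone_time α (cemetery S)] with ω h0 hmono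
      rintro ⟨n, -, hn⟩
      have htop : (ω n).time = ∞ := by
        rw [← top_le_iff, ← (time_eq_top_iff _).2 h0]
        exact hmono (Nat.zero_le n)
      exact hc ((time_eq_top_iff _).1 htop ▸ hn)
    · have hc := hmem A hA hpos
      refine (mem_ae_iff_prob_eq_one (measurableSet_frequently_mem hA)).1 ?_
      filter_upwards [q.ae_eventually_eq_cemetery h z] with ω hω
      exact (hω.mono fun n hn => hn ▸ hc).frequently

end QFunction

end PureJump

theorem theorem3p1 {S : Type*} [MeasurableSpace S] [StandardBorelSpace S] [Nonempty S]
    (q : PureJump.QFunction S) :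
    (q.Nonexplosive ↔
      ∃ α : ℝ≥0, 0 < α ∧
        PureJump.IsHarrisRecurrent (q.stepKernel α) (Measure.dirac (PureJump.cemetery S))) ∧
    (q.Nonexplosive ↔
      ∀ α : ℝ≥0, 0 < α →
        ¬ ∃ U : ℝ≥0 × S → ℝ≥0∞, q.IsUnitSolution α U ∧ ∃ p, U p ≠ 0) ∧
    ((∃ α : ℝ≥0, 0 < α ∧
        PureJump.IsHarrisRecurrent (q.stepKernel α) (Measure.dirac (PureJump.cemetery S))) ↔
      ∀ α : ℝ≥0, 0 < α →
        ¬ ∃ U : ℝ≥0 × S → ℝ≥0∞, q.IsUnitSolution α U ∧ ∃ p, U p ≠ 0) := by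
  have h12 : q.Nonexplosive ↔ ∃ α : ℝ≥0, 0 < α ∧
      PureJump.IsHarrisRecurrent (q.stepKernel α) (Measure.dirac (PureJump.cemetery S)) := by
    refine ⟨fun h => ⟨1, one_pos, ?_⟩, fun ⟨α, hα, h⟩ => ?_⟩
    · exact (q.isHarrisRecurrent_iff 1).2 ((q.nonexplosive_iff_explosionTransform one_pos).1 h)
    · exact (q.nonexplosive_iff_explosionTransform hα).2 ((q.isHarrisRecurrent_iff α).1 h)
  have h13 : q.Nonexplosive ↔ ∀ α : ℝ≥0, 0 < α →
      ¬ ∃ U : ℝ≥0 × S → ℝ≥0∞, q.IsUnitSolution α U ∧ ∃ p, U p ≠ 0 := by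
    simp only [q.not_exists_isUnitSolution_iff]
    exact ⟨fun h α hα => (q.nonexplosive_iff_explosionTransform hα).1 h,
      fun h => (q.nonexplosive_iff_explosionTransform one_pos).2 (h 1 one_pos)⟩
  exact ⟨h12, h13, h12.symm.trans h13⟩
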